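/- Let $X\in\mathbb R^{n\times m}$ satisfy $X^{T}X=I_m$, let $\beta\in\mathbb R^m$, and let $y=X\beta+\varepsilon$ with $\varepsilon\sim N(0,\sigma^2I_n)$, where $\sigma\ge 0$ is known. Let $\alpha\in(0,1)$ and let $k\ge 1$ be an integer. Put $$\lambda_i=\begin{cases}\Phi^{-1}\!\left(1-\dfrac{k\alpha}{2m}\right), & i\le k,\\[2mm] \Phi^{-1}\!\left(1-\dfrac{k\alpha}{2(m+k-i)}\right), & i>k,\end{cases}\qquad i=1,\dots,m,$$ where $\Phi$ is the standard normal distribution function, and let $\hat\beta$ be the $k$-SLOPE estimator, that is, $$\hat\beta\in\mathop{\arg\min}_{b\in\mathbb R^m}\ \tfrac12\|y-Xb\|_2^2+\sigma\sum_{i=1}^m\lambda_i|b|_{(i)},$$ where $|b|_{(1)}\ge\cdots\ge|b|_{(m)}$ are the absolute values of the coordinates of $b$ in non-increasing order. Let $V=\#\{i:\beta_i=0,\ \hat\beta_i\ne 0\}$ be the number of falsely selected features. Then the $k$-family-wise error rate satisfies $$k\text{-}\mathrm{FWER}=\mathbb P(V\ge k)\le\alpha .$$ (For $k>m$ the bound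 is trivial, since $V\le m$, whatever value is given to $\Phi^{-1}$ outside $(0,1)$.) -/

import Mathlib

open MeasureTheory ProbabilityTheory

/-- The quantile function `Φ⁻¹` of the standard normal distribution,
`Φ⁻¹(p) = inf {x | p ≤ Φ(x)}`; on `(0, 1)` it is the inverse of the distribution function `Φ`. -/
noncomputable def stdNormalQuantile (p : ℝ) : ℝ :=
  sInf {x : ℝ | p ≤ cdf (gaussianReal 0 1) x}

/-- The regularization sequence of `k`-SLOPE with `m` features at level `α`,
indexed by `i = 1, …, m`. -/
noncomputable def lambdaKFWER (m k : ℕ) (α : ℝ) (i : ℕ) : ℝ :=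
  if i ≤ k then stdNormalQuantile (1 - k * α / (2 * m))
  else stdNormalQuantile (1 - k * α / (2 * ((m : ℝ) + k - i)))

/-- `absSorted b i` is the `(i + 1)`-st largest of the absolute values `|b j|`, that is,
`|b|_(i+1)` in `|b|_(1) ≥ |b|_(2) ≥ ⋯ ≥ |b|_(m)`. -/
noncomputable def absSorted {m : ℕ} (b : EuclideanSpace ℝ (Fin m)) (i : Fin m) : ℝ :=
  |b (Tuple.sort (fun j => -|b j|) i)|

/-- The sorted absolute values are in non-increasing order. -/
theorem absSorted_antitone {m : ℕ} (b : EuclideanSpace ℝ (Fin m)) : Antitone (absSorted b) := by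
  intro i j hij
  have h := Tuple.monotone_sort (fun j => -|b j|) hij
  simpa [absSorted] using h

/-- The sorted `ℓ₁` penalty `J_l(b) = ∑ i = 1, …, m, l i * |b|_(i)`. -/
noncomputable def sortedL1 {m : ℕ} (l : ℕ → ℝ) (b : EuclideanSpace ℝ (Fin m)) : ℝ :=
  ∑ i : Fin m, l (i + 1) * absSorted b i

/-- The objective function of `k`-SLOPE for the design matrix `X` and the response `y`. -/
noncomputable def kSlopeObjective {n m : ℕ} (X : Matrix (Fin n) (Fin m) ℝ) (σ : ℝ) (k : ℕ) (α : ℝ)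
    (y : EuclideanSpace ℝ (Fin n)) (b : EuclideanSpace ℝ (Fin m)) : ℝ :=
  1 / 2 * ‖y - WithLp.toLp 2 (X.mulVec b.ofLp)‖ ^ 2 + σ * sortedL1 (lambdaKFWER m k α) b

/-- `b` is a `k`-SLOPE estimate: it minimizes the `k`-SLOPE objective over `ℝᵐ`. -/
def IsKSlopeEstimate {n m : ℕ} (X : Matrix (Fin n) (Fin m) ℝ) (σ : ℝ) (k : ℕ) (α : ℝ)
    (y : EuclideanSpace ℝ (Fin n)) (b : EuclideanSpace ℝ (Fin m)) : Prop :=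
  ∀ b' : EuclideanSpace ℝ (Fin m), kSlopeObjective X σ k α y b ≤ kSlopeObjective X σ k α y b'

/-- The number `V` of false discoveries: the features `i` with `β i = 0` that the estimate `b`
selects (`b i ≠ 0`). -/
noncomputable def numFalseDiscoveries {m : ℕ} (β b : EuclideanSpace ℝ (Fin m)) : ℕ :=
  (Finset.univ.filter fun i : Fin m => β i = 0 ∧ b i ≠ 0).card

/-- The `k`-family-wise error rate `Prob (V ≥ k)` of the estimator `βhat`. -/
noncomputable def kFWER {Ω : Type*} [MeasurableSpace Ω] (P : Measure Ω) {m : ℕ} (k : ℕ)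
    (β : EuclideanSpace ℝ (Fin m)) (βhat : Ω → EuclideanSpace ℝ (Fin m)) : ℝ :=
  P.real {ω | k ≤ numFalseDiscoveries β (βhat ω)}

/-! Orthonormal columns give Xᵀy = β + Xᵀε, where Xᵀε has independent N(0, σ²) coordinates. If r
features are selected, resetting a selected coordinate i to 0 cannot lower the objective, which
forces |(Xᵀy)_i| ≥ σ λ_r (`IsKSlopeEstimate.le_abs_mulVec`). With m₀ true nulls, r ≤ V + m - m₀. As
λ is non-increasing, V ≥ k false discoveries need V null coordinates of Xᵀε of absolute value at
least σ λ_(V+m-m₀) (`IsKSlopeEstimate.le_abs_noise`). The choice of λ makes the tail at this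
threshold at most kα/(m₀+k-V) ≤ Vα/m₀ for k ≤ V ≤ m₀ (`prob_lambdaKFWER_le`). Since V is random, all
its values are treated at once by `simes_inequality` with c = α/m₀, whose bound m₀c is α. -/

/-! ### Simes' inequality -/

/-- **Simes' inequality** for independent random variables: for a monotone family of rejection
regions `A v`, each of probability at most `v * c` under every `X i`, the probability that for
some `v ≥ 1` at least `v` of the variables fall in `A v` is at most `card ι * c`. -/
theorem simes_inequality {Ω ι : Type*} [MeasurableSpace Ω] {μ : Measure Ω} [IsProbabilityMeasure μ]
    [Fintype ι] {X : ι → Ω → ℝ} (hX : ∀ i, Measurable (X i)) (hind : iIndepFun X μ)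
    {A : ℕ → Set ℝ} (hA : Monotone A) (hAm : ∀ v, MeasurableSet (A v)) {c : ENNReal}
    (hc : ∀ i v, μ (X i ⁻¹' A v) ≤ v * c) :
    μ {ω | ∃ v, 1 ≤ v ∧ v ≤ Set.ncard {i | X i ω ∈ A v}} ≤ Fintype.card ι * c := by
  classical
  set N := Fintype.card ι with hN
  let C : ∀ i : ι, ℕ → ({j // j ∈ Finset.univ.erase i} → ℝ) → ℕ :=
    fun i v x => ∑ j, (A v).indicator (fun _ => 1) (x j)
  have hCm : ∀ i v, Measurable (C i v) := fun i v => by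
    refine Finset.measurable_sum _ fun j _ => ?_
    exact (measurable_const.indicator (hAm v)).comp (measurable_pi_apply j)
  -- For v ≤ N, `T i v` says that v is the largest w ≤ N with w ≤ 1 + (number of j ≠ i in `A w`). It
  -- involves only the variables other than `X i`, hence is independent of `X i`, and is disjoint
  -- for distinct v.
  let T : ∀ i : ι, ℕ → Set ({j // j ∈ Finset.univ.erase i} → ℝ) :=
    fun i v => {x | v ≤ 1 + C i v x} ∩ ⋂ w ∈ Finset.Ioc v N, {x | w ≤ 1 + C i w x}ᶜ
  have hlem : ∀ i v, MeasurableSet {x | v ≤ 1 + C i v x} := fun i v =>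
    measurableSet_le measurable_const (measurable_const.add (hCm i v))
  have hTm : ∀ i v, MeasurableSet (T i v) := fun i v =>
    (hlem i v).inter (Finset.measurableSet_biInter _ fun w _ => (hlem i w).compl)
  have hTd : ∀ i, Set.PairwiseDisjoint (↑(Finset.Icc 1 N)) (T i) := by
    have key : ∀ i v w, w ≤ N → v < w → Disjoint (T i v) (T i w) := by
      intro i v w hw hvw
      refine Set.disjoint_left.2 fun x hx hx' => ?_
      have := Set.mem_iInter₂.1 hx.2 w (Finset.mem_Ioc.2 ⟨hvw, hw⟩)
      exact this hx'.1
    intro i v hv w hw hvw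
    simp only [Finset.coe_Icc, Set.mem_Icc] at hv hw
    rcases lt_or_gt_of_ne hvw with h | h
    · exact key i v w hw.2 h
    · exact (key i w v hv.2 h).symm
  let g : ∀ i : ι, Ω → ({j // j ∈ Finset.univ.erase i} → ℝ) := fun i ω j => X j ω
  have hg : ∀ i, Measurable (g i) := fun i => measurable_pi_lambda _ fun j => hX j
  have hig : ∀ i, IndepFun (X i) (g i) μ := fun i => by
    have h := hind.indepFun_finset {i} (Finset.univ.erase i) (by simp) hX
    exact h.comp (φ := fun x : (({i} : Finset ι) : Type _) → ℝ =>
      x ⟨i, Finset.mem_singleton_self i⟩) (ψ := id) (measurable_pi_apply _) measurable_id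
  let S : ι → ℕ → Set Ω := fun i v => X i ⁻¹' A v ∩ g i ⁻¹' T i v
  have hSm : ∀ i v, MeasurableSet (S i v) := fun i v =>
    (hX i (hAm v)).inter (hg i (hTm i v))
  -- At the largest v attained by the full count, at least v indices contribute 1/v each, so f ≥ 1
  -- on the event and Markov's inequality applies.
  let f : Ω → ENNReal := fun ω =>
    ∑ i, ∑ v ∈ Finset.Icc 1 N, (S i v).indicator (fun _ => (v : ENNReal)⁻¹) ω
  have hf : Measurable f := by
    refine Finset.measurable_sum _ fun i _ => Finset.measurable_sum _ fun v _ => ?_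
    exact measurable_const.indicator (hSm i v)
  have hcount : ∀ i v ω, X i ω ∈ A v → 1 + C i v (g i ω) = Set.ncard {j | X j ω ∈ A v} := by
    intro i v ω hi
    have h1 : C i v (g i ω) = ∑ j ∈ Finset.univ.erase i, if X j ω ∈ A v then 1 else 0 := by
      rw [← Finset.sum_coe_sort]
      simp [C, g, Set.indicator_apply]
    have h2 := Finset.add_sum_erase Finset.univ (fun j => if X j ω ∈ A v then 1 else 0)
      (Finset.mem_univ i)
    rw [h1, Set.ncard_eq_toFinset_card', Set.toFinset_ofPred, Finset.card_filter, ← h2]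
    simp [hi]
  have hsub : {ω | ∃ v, 1 ≤ v ∧ v ≤ Set.ncard {i | X i ω ∈ A v}} ⊆ {ω | 1 ≤ f ω} := by
    rintro ω ⟨v₀, hv₀, hv₀'⟩
    have hle : ∀ v, Set.ncard {i | X i ω ∈ A v} ≤ N := fun v => by
      rw [hN, ← Nat.card_eq_fintype_card]; exact Set.ncard_le_card _
    let Q : ℕ → Prop := fun v => v ≤ Set.ncard {i | X i ω ∈ A v}
    set V := Nat.findGreatest Q N with hV
    have hV0 : v₀ ≤ V := Nat.le_findGreatest (hv₀'.trans (hle _)) hv₀'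
    have hQV : Q V := Nat.findGreatest_spec (P := Q) (hv₀'.trans (hle _)) hv₀'
    have hV1 : 1 ≤ V := hv₀.trans hV0
    have hVN : V ≤ N := Nat.findGreatest_le N
    have hmem : ∀ i, X i ω ∈ A V → ω ∈ S i V := by
      intro i hi
      refine ⟨hi, ?_, ?_⟩
      · change V ≤ 1 + C i V (g i ω)
        rw [hcount i V ω hi]; exact hQV
      · refine Set.mem_iInter₂.2 fun w hw => ?_
        rw [Finset.mem_Ioc] at hw
        change ¬ (w ≤ 1 + C i w (g i ω))
        -- Monotonicity keeps i in `A w` for every w > V, so the leave-one-out count plus one is the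
        -- full count there too.
        rw [hcount i w ω (hA hw.1.le hi)]
        exact Nat.findGreatest_is_greatest (P := Q) hw.1 hw.2
    calc (1 : ENNReal) = V * (V : ENNReal)⁻¹ := by
          rw [ENNReal.mul_inv_cancel (by exact_mod_cast (by omega : V ≠ 0)) (by simp)]
      _ ≤ (Set.ncard {i | X i ω ∈ A V} : ℕ) * (V : ENNReal)⁻¹ := by gcongr
      _ = ∑ i, if X i ω ∈ A V then (V : ENNReal)⁻¹ else 0 := by
          rw [← Finset.sum_filter, Finset.sum_const, nsmul_eq_mul,
            Set.ncard_eq_toFinset_card', Set.toFinset_ofPred]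
      _ ≤ f ω := by
          refine Finset.sum_le_sum fun i _ => ?_
          split_ifs with hi
          · refine le_trans ?_ (Finset.single_le_sum (fun _ _ => zero_le)
              (Finset.mem_Icc.2 ⟨hV1, hVN⟩))
            rw [Set.indicator_of_mem (hmem i hi)]
          · exact zero_le
  calc μ {ω | ∃ v, 1 ≤ v ∧ v ≤ Set.ncard {i | X i ω ∈ A v}}
      ≤ μ {ω | 1 ≤ f ω} := measure_mono hsub
    _ ≤ ∫⁻ ω, f ω ∂μ := by simpa using mul_meas_ge_le_lintegral hf 1
    _ = ∑ i, ∑ v ∈ Finset.Icc 1 N, (v : ENNReal)⁻¹ * μ (S i v) := by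
        rw [lintegral_finsetSum _ fun i _ => Finset.measurable_sum _ fun v _ =>
          measurable_const.indicator (hSm i v)]
        refine Finset.sum_congr rfl fun i _ => ?_
        rw [lintegral_finsetSum _ fun v _ => measurable_const.indicator (hSm i v)]
        exact Finset.sum_congr rfl fun v _ => lintegral_indicator_const (hSm i v) _
    _ ≤ ∑ i : ι, ∑ v ∈ Finset.Icc 1 N, c * μ (g i ⁻¹' T i v) := by
        refine Finset.sum_le_sum fun i _ => Finset.sum_le_sum fun v hv => ?_
        rw [(hig i).measure_inter_preimage_eq_mul _ _ (hAm v) (hTm i v), ← mul_assoc]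
        gcongr
        have hv0 : (v : ENNReal) ≠ 0 := by
          have := (Finset.mem_Icc.1 hv).1
          exact_mod_cast (by omega : v ≠ 0)
        calc (v : ENNReal)⁻¹ * μ (X i ⁻¹' A v) ≤ (v : ENNReal)⁻¹ * (v * c) := by
              gcongr; exact hc i v
          _ = c := by rw [← mul_assoc, ENNReal.inv_mul_cancel hv0 (by simp), one_mul]
    _ ≤ ∑ i : ι, c := by
        refine Finset.sum_le_sum fun i _ => ?_
        rw [← Finset.mul_sum, ← measure_biUnion_finset
          (fun v hv w hw hvw => (hTd i hv hw hvw).preimage (g i)) fun v _ => hg i (hTm i v)]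
        exact mul_le_of_le_one_right' prob_le_one
    _ = N * c := by simp [hN]

/-! ### Quantiles and tails of the standard normal distribution -/

theorem stdNormalQuantile_bddBelow {p : ℝ} (hp : 0 < p) :
    BddBelow {x : ℝ | p ≤ cdf (gaussianReal 0 1) x} := by
  obtain ⟨a, ha⟩ := ((tendsto_cdf_atBot (gaussianReal 0 1)).eventually_lt_const hp).exists
  refine ⟨a, fun x hx => ?_⟩
  by_contra! h
  exact absurd (hx.trans (monotone_cdf _ h.le)) (not_le.2 ha)

theorem stdNormalQuantile_nonempty {p : ℝ} (hp : p < 1) :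
    {x : ℝ | p ≤ cdf (gaussianReal 0 1) x}.Nonempty := by
  obtain ⟨a, ha⟩ := ((tendsto_cdf_atTop (gaussianReal 0 1)).eventually_const_lt hp).exists
  exact ⟨a, ha.le⟩

theorem stdNormalQuantile_mono {p q : ℝ} (hp : 0 < p) (hpq : p ≤ q) (hq : q < 1) :
    stdNormalQuantile p ≤ stdNormalQuantile q :=
  csInf_le_csInf (stdNormalQuantile_bddBelow hp) (stdNormalQuantile_nonempty hq)
    fun _ hx => hpq.trans hx

/-- Right continuity of the distribution function suffices: only this half of the inversion enters
the tail bound. -/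
theorem le_cdf_stdNormalQuantile {p : ℝ} (hp : p < 1) :
    p ≤ cdf (gaussianReal 0 1) (stdNormalQuantile p) := by
  have hcont : Filter.Tendsto (cdf (gaussianReal 0 1))
      (nhdsWithin (stdNormalQuantile p) (Set.Ioi (stdNormalQuantile p)))
      (nhds (cdf (gaussianReal 0 1) (stdNormalQuantile p))) :=
    ((cdf (gaussianReal 0 1)).right_continuous _).mono_left
      (nhdsWithin_mono _ Set.Ioi_subset_Ici_self)
  refine ge_of_tendsto hcont ?_
  filter_upwards [self_mem_nhdsWithin] with x hx
  obtain ⟨z, hz, hzx⟩ := exists_lt_of_csInf_lt (stdNormalQuantile_nonempty hp) hx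
  exact le_trans hz (monotone_cdf _ hzx.le)

/-- Two-sided tail bound at a quantile of the standard normal distribution. -/
theorem gaussianReal_abs_ge_stdNormalQuantile {p : ℝ} (hp : p < 1) :
    gaussianReal 0 1 {x | stdNormalQuantile p ≤ |x|} ≤ ENNReal.ofReal (2 * (1 - p)) := by
  set q := stdNormalQuantile p
  have := nullSingletonClass_gaussianReal (μ := 0) (v := 1) one_ne_zero
  have h1 : gaussianReal 0 1 (Set.Ici q) ≤ ENNReal.ofReal (1 - p) := by
    rw [← measure_congr (Ioi_ae_eq_Ici (μ := gaussianReal 0 1) (a := q)), ← Set.compl_Iic,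
      prob_compl_eq_one_sub measurableSet_Iic, ← ofReal_cdf, ← ENNReal.ofReal_one,
      ← ENNReal.ofReal_sub _ (cdf_nonneg _ _)]
    exact ENNReal.ofReal_le_ofReal (by linarith [le_cdf_stdNormalQuantile hp])
  have h2 : gaussianReal 0 1 (Set.Iic (-q)) = gaussianReal 0 1 (Set.Ici q) := by
    have h := gaussianReal_map_neg (μ := 0) (v := 1)
    rw [neg_zero] at h
    conv_lhs => rw [← h]
    rw [Measure.map_apply measurable_neg measurableSet_Iic]
    congr 1
    ext x
    simp
  have hsub : {x : ℝ | q ≤ |x|} ⊆ Set.Ici q ∪ Set.Iic (-q) := by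
    intro x hx
    rcases le_abs.1 (show q ≤ |x| from hx) with h | h
    · exact Or.inl h
    · exact Or.inr (by simp only [Set.mem_Iic]; linarith)
  calc gaussianReal 0 1 {x | q ≤ |x|} ≤ gaussianReal 0 1 (Set.Ici q ∪ Set.Iic (-q)) :=
        measure_mono hsub
    _ ≤ _ := measure_union_le _ _
    _ ≤ ENNReal.ofReal (1 - p) + ENNReal.ofReal (1 - p) := by rw [h2]; gcongr
    _ = ENNReal.ofReal (2 * (1 - p)) := by
        rw [← ENNReal.ofReal_add (by linarith) (by linarith)]; congr 1; ring

/-! ### Monotonicity of the regularization sequence -/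

theorem lambdaKFWER_eq (m k : ℕ) (α : ℝ) (i : ℕ) :
    lambdaKFWER m k α i =
      stdNormalQuantile (1 - k * α / (2 * ((m : ℝ) + k - max (i : ℝ) (k : ℝ)))) := by
  unfold lambdaKFWER
  split_ifs with h
  · rw [max_eq_right (by exact_mod_cast h)]; simp
  · rw [max_eq_left (by exact_mod_cast (not_le.1 h).le)]

/-- For i ≤ m and k ≤ m the denominators are at least 2k, which keeps the quantile's argument in (0,
1), where `sInf` is a genuine infimum and not a default value. -/
theorem lambdaKFWER_antitoneOn {m k : ℕ} {α : ℝ} (hk : 1 ≤ k) (hkm : k ≤ m)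
    (hα : α ∈ Set.Ioo (0 : ℝ) 1) : AntitoneOn (lambdaKFWER m k α) (Set.Icc 1 m) := by
  intro i hi j hj hij
  have hk0 : (1 : ℝ) ≤ k := by exact_mod_cast hk
  have hα0 := hα.1
  have hden : ∀ i ≤ m, (k : ℝ) ≤ (m : ℝ) + k - max (i : ℝ) k := by
    intro i hi
    have : max (i : ℝ) k ≤ m := max_le (by exact_mod_cast hi) (by exact_mod_cast hkm)
    linarith
  have hmax : max (i : ℝ) k ≤ max (j : ℝ) k := max_le_max_right _ (by exact_mod_cast hij)
  have hi' := hden i hi.2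
  have hj' := hden j hj.2
  rw [lambdaKFWER_eq, lambdaKFWER_eq]
  refine stdNormalQuantile_mono ?_ ?_ ?_
  · rw [sub_pos, div_lt_one (by linarith)]
    nlinarith [hα.2]
  · gcongr
    linarith
  · have : 0 < k * α / (2 * ((m : ℝ) + k - max (i : ℝ) k)) :=
      div_pos (by positivity) (by linarith)
    linarith

/-! ### The sorted ℓ₁ norm and the size of selected coordinates -/

/-- This is the rearrangement inequality. -/
theorem sum_mul_abs_perm_le_sortedL1 {m : ℕ} {l : ℕ → ℝ} (hl : AntitoneOn l (Set.Icc 1 m))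
    (b : EuclideanSpace ℝ (Fin m)) (π : Equiv.Perm (Fin m)) :
    ∑ i : Fin m, l (i + 1) * |b (π i)| ≤ sortedL1 l b := by
  have hl' : Antitone fun i : Fin m => l (i + 1) := fun i j hij =>
    hl ⟨by omega, by omega⟩ ⟨by omega, by omega⟩ (by simpa using hij)
  have h := (hl'.monovary (absSorted_antitone b)).sum_mul_comp_perm_le_sum_mul
    (σ := π.trans (Tuple.sort fun j => -|b j|).symm)
  simpa [absSorted, sortedL1] using h

/-- Deleting one of the `r` nonzero coordinates decreases the sorted `ℓ₁` norm by at least `l r`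
times its absolute value. -/
theorem sortedL1_add_le_of_delete {m : ℕ} {l : ℕ → ℝ} (hl : AntitoneOn l (Set.Icc 1 m))
    {b b' : EuclideanSpace ℝ (Fin m)} {i : Fin m} (hi : b i ≠ 0) (hi' : b' i = 0)
    (hb : ∀ j, j ≠ i → b' j = b j) :
    sortedL1 l b' + l (Finset.univ.filter fun j => b j ≠ 0).card * |b i| ≤ sortedL1 l b := by
  set S := Finset.univ.filter fun j => b j ≠ 0 with hS
  have hiS : i ∈ S := by simp [hS, hi]
  have hS1 : 1 ≤ S.card := Finset.card_pos.2 ⟨i, hiS⟩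
  have hSm : S.card ≤ m := by simpa using Finset.card_le_univ S
  set s := Tuple.sort fun j => -|b' j| with hs
  -- The slot of rank `S.card`, counted from 0. It holds a zero of b', which has only `S.card - 1`
  -- nonzero coordinates.
  let p : Fin m := ⟨S.card - 1, by omega⟩
  have hp : b' (s p) = 0 := by
    by_contra hne
    have hpos : 0 < absSorted b' p := abs_pos.2 hne
    have hsub : (Finset.Iic p).map s.toEmbedding ⊆ S.erase i := by
      intro j hj
      obtain ⟨q, hq, rfl⟩ := Finset.mem_map.1 hj
      have hq0 : 0 < absSorted b' q := hpos.trans_le (absSorted_antitone b' (Finset.mem_Iic.1 hq))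
      have hq1 : b' (s q) ≠ 0 := abs_pos.1 hq0
      have hqi : s q ≠ i := fun h => hq1 (h ▸ hi')
      simp only [Equiv.coe_toEmbedding, Finset.mem_erase, hS, Finset.mem_filter, Finset.mem_univ,
        true_and]
      exact ⟨hqi, hb _ hqi ▸ hq1⟩
    have := Finset.card_le_card hsub
    rw [Finset.card_map, Fin.card_Iic, Finset.card_erase_of_mem hiS] at this
    simp only [p] at this
    omega
  -- The swap exchanges two slots where b' vanishes, so π still sorts |b'|, and it puts i at rank
  -- `S.card`. Along π the weighted sums of b and b' differ only by the term of i.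
  let π : Equiv.Perm (Fin m) := (Equiv.swap p (s.symm i)).trans s
  have hπp : π p = i := by simp [π]
  have h1 : ∀ j : Fin m, |b' (π j)| = absSorted b' j := by
    intro j
    change |b' (s (Equiv.swap p (s.symm i) j))| = |b' (s j)|
    rcases eq_or_ne j p with rfl | hjp
    · simp [hi', hp]
    · rcases eq_or_ne j (s.symm i) with rfl | hji
      · simp [hi', hp]
      · rw [Equiv.swap_apply_of_ne_of_ne hjp hji]
  have h2 : ∀ j : Fin m, l (j + 1) * |b (π j)| =
      l (j + 1) * absSorted b' j + if j = p then l S.card * |b i| else 0 := by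
    intro j
    split_ifs with hj
    · subst hj
      rw [← h1, hπp, hi', show (p : ℕ) + 1 = S.card by simp only [p]; omega]
      simp
    · rw [← h1, hb (π j) fun h => hj (π.injective (h.trans hπp.symm)), add_zero]
  refine le_trans (le_of_eq ?_) (sum_mul_abs_perm_le_sortedL1 hl b π)
  simp_rw [h2]
  rw [Finset.sum_add_distrib, Finset.sum_ite_eq' Finset.univ p]
  simp [sortedL1]

/-- For an orthogonal design, a feature selected by `k`-SLOPE with `r` selected features has a
marginal statistic of size at least `σ * λ_r`. -/
theorem IsKSlopeEstimate.le_abs_mulVec {n m : ℕ} {X : Matrix (Fin n) (Fin m) ℝ}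
    (hX : X.transpose * X = 1) {σ : ℝ} (hσ : 0 ≤ σ) {k : ℕ} (hk : 1 ≤ k) (hkm : k ≤ m) {α : ℝ}
    (hα : α ∈ Set.Ioo (0 : ℝ) 1) {y : EuclideanSpace ℝ (Fin n)} {b : EuclideanSpace ℝ (Fin m)}
    (hb : IsKSlopeEstimate X σ k α y b) {i : Fin m} (hi : b i ≠ 0) :
    σ * lambdaKFWER m k α (Finset.univ.filter fun j => b j ≠ 0).card + |b i| / 2 ≤
      |X.transpose.mulVec y.ofLp i| := by
  let b' : EuclideanSpace ℝ (Fin m) := b - EuclideanSpace.single i (b i)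
  have hJ := sortedL1_add_le_of_delete (lambdaKFWER_antitoneOn hk hkm hα) (b' := b') hi
    (by simp [b']) (fun j hj => by simp [b', hj])
  have hmin := hb b'
  unfold kSlopeObjective at hmin
  set w : EuclideanSpace ℝ (Fin n) := y - WithLp.toLp 2 (X.mulVec b.ofLp) with hw
  set e : EuclideanSpace ℝ (Fin n) := WithLp.toLp 2 (X.mulVec (Pi.single i (b i))) with he
  have hw' : y - WithLp.toLp 2 (X.mulVec b'.ofLp) = w + e := by
    have : b'.ofLp = b.ofLp - Pi.single i (b i) := rfl
    rw [this, Matrix.mulVec_sub, WithLp.toLp_sub, hw, he]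
    abel
  have hinner : ∀ u : EuclideanSpace ℝ (Fin n),
      inner ℝ u e = b i * X.transpose.mulVec u.ofLp i := by
    intro u
    rw [EuclideanSpace.inner_eq_star_dotProduct, he]
    simp only [star_trivial]
    rw [dotProduct_comm, Matrix.dotProduct_mulVec, ← Matrix.mulVec_transpose, dotProduct_single,
      mul_comm]
  have hwe : inner ℝ w e = b i * (X.transpose.mulVec y.ofLp i - b i) := by
    rw [hinner, hw, WithLp.ofLp_sub, Matrix.mulVec_sub, Matrix.mulVec_mulVec, hX]
    simp
  have hee : ‖e‖ ^ 2 = b i ^ 2 := by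
    rw [← real_inner_self_eq_norm_sq, hinner, he]
    simp only [Matrix.mulVec_mulVec, hX, Matrix.one_mulVec, Pi.single_eq_same]
    ring
  rw [hw', norm_add_sq_real, hwe, hee] at hmin
  have hJ' := mul_le_mul_of_nonneg_left hJ hσ
  have habs : b i * X.transpose.mulVec y.ofLp i ≤ |b i| * |X.transpose.mulVec y.ofLp i| := by
    rw [← abs_mul]; exact le_abs_self _
  have hsq : b i ^ 2 = |b i| ^ 2 := (sq_abs _).symm
  have hpos : 0 < |b i| := abs_pos.2 hi
  -- Deleting coordinate i changes the quadratic term by b_i (Xᵀy)_i - b_i²/2; dividing the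
  -- comparison by |b_i| leaves the surplus |b_i|/2.
  refine le_of_mul_le_mul_left ?_ hpos
  nlinarith

/-! ### Law of the noise statistics and their tails at λ -/

/-- Orthonormal linear functionals of white noise, rescaled, are independent standard normal. -/
theorem gaussianReal_iIndepFun_mulVec_transpose_multivariateGaussian
    {n m : ℕ} {X : Matrix (Fin n) (Fin m) ℝ} (hX : X.transpose * X = 1) {σ : ℝ} (hσ : 0 < σ) (i : Fin m) :
    (multivariateGaussian 0 (σ ^ 2 • (1 : Matrix (Fin n) (Fin n) ℝ))).map
      (fun e => σ⁻¹ * X.transpose.mulVec e.ofLp i) = gaussianReal 0 1 ∧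
    iIndepFun (fun (i : Fin m) (e : EuclideanSpace ℝ (Fin n)) =>
      σ⁻¹ * X.transpose.mulVec e.ofLp i)
      (multivariateGaussian 0 (σ ^ 2 • (1 : Matrix (Fin n) (Fin n) ℝ))) := by
  set G := multivariateGaussian 0 (σ ^ 2 • (1 : Matrix (Fin n) (Fin n) ℝ)) with hG
  have hpsd : (σ ^ 2 • (1 : Matrix (Fin n) (Fin n) ℝ)).PosSemidef :=
    Matrix.PosSemidef.one.smul (sq_nonneg σ)
  let u : Fin m → EuclideanSpace ℝ (Fin n) := fun i => σ⁻¹ • WithLp.toLp 2 (X.col i)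
  have hu : ∀ (i : Fin m) (e : EuclideanSpace ℝ (Fin n)),
      σ⁻¹ * X.transpose.mulVec e.ofLp i = innerSL ℝ (u i) e := by
    intro i e
    rw [innerSL_apply_apply, real_inner_smul_left, EuclideanSpace.inner_eq_star_dotProduct,
      star_trivial, dotProduct_comm]
    rfl
  have hdot : ∀ i j, (X.col i) ⬝ᵥ (X.col j) = (1 : Matrix (Fin m) (Fin m) ℝ) i j := by
    intro i j
    rw [← hX, Matrix.mul_apply]
    rfl
  have hcov : ∀ i j, cov[fun e => innerSL ℝ (u i) e, fun e => innerSL ℝ (u j) e; G] =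
      (1 : Matrix (Fin m) (Fin m) ℝ) i j := by
    intro i j
    have h := covarianceBilin_apply_eq_cov (μ := G) IsGaussian.memLp_two_id (u i) (u j)
    simp only [innerSL_apply_apply]
    rw [← h, hG, covarianceBilin_multivariateGaussian hpsd, ← hdot i j]
    simp only [u, WithLp.ofLp_smul, Matrix.smul_mulVec, Matrix.one_mulVec, smul_dotProduct,
      dotProduct_smul, smul_eq_mul]
    field_simp
  simp_rw [hu]
  constructor
  · rw [IsGaussian.map_eq_gaussianReal, ContinuousLinearMap.integral_comp_id_comm]
    · rw [← covariance_self (by fun_prop), hcov, hG, integral_id_multivariateGaussian]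
      simp
    · exact IsGaussian.integrable_id
  -- The functionals are jointly Gaussian, as a linear image of Gaussian noise, so vanishing
  -- covariances give independence.
  · refine HasGaussianLaw.iIndepFun_of_covariance_eq_zero ?_ fun i j hij => ?_
    · have h : HasGaussianLaw (id : EuclideanSpace ℝ (Fin n) → _) G := IsGaussian.hasGaussianLaw_id
      exact h.map (ContinuousLinearMap.pi fun i => innerSL ℝ (u i))
    · rw [hcov, Matrix.one_apply_ne hij]

/-- The bound kα/(m₀+k-w) ≤ wα/m₀ amounts to (w-k)(m₀-w) ≥ 0, with equality at w = k and w = m₀. -/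
theorem prob_lambdaKFWER_le {m k : ℕ} {α : ℝ} (hk : 1 ≤ k) (hα : α ∈ Set.Ioo (0 : ℝ) 1)
    {m₀ w : ℕ} (hm₀ : m₀ ≤ m) (hkw : k ≤ w) (hw : w ≤ m₀) :
    gaussianReal 0 1 {x | lambdaKFWER m k α (w + (m - m₀)) ≤ |x|} ≤
      w * ENNReal.ofReal (α / m₀) := by
  have hk0 : (1 : ℝ) ≤ k := by exact_mod_cast hk
  have hkw' : (k : ℝ) ≤ w := by exact_mod_cast hkw
  have hw' : (w : ℝ) ≤ m₀ := by exact_mod_cast hw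
  have hα0 := hα.1
  have hd : (m : ℝ) + k - max ((w + (m - m₀) : ℕ) : ℝ) (k : ℝ) = m₀ + k - w := by
    rw [max_eq_left (by exact_mod_cast (by omega : k ≤ w + (m - m₀)))]
    push_cast [hm₀]
    ring
  have hpos : (0 : ℝ) < m₀ + k - w := by linarith
  rw [lambdaKFWER_eq, hd]
  refine (gaussianReal_abs_ge_stdNormalQuantile ?_).trans ?_
  · have : 0 < k * α / (2 * ((m₀ : ℝ) + k - w)) := by positivity
    linarith
  · rw [← ENNReal.ofReal_natCast w, ← ENNReal.ofReal_mul (by positivity)]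
    refine ENNReal.ofReal_le_ofReal ?_
    have e : 2 * (1 - (1 - k * α / (2 * ((m₀ : ℝ) + k - w)))) = k * α / (m₀ + k - w) := by
      field_simp
      ring
    rw [e, ← mul_div_assoc, div_le_div_iff₀ hpos (by linarith)]
    have : (k : ℝ) * m₀ ≤ w * (m₀ + k - w) := by
      nlinarith [mul_nonneg (sub_nonneg.2 hkw') (sub_nonneg.2 hw')]
    nlinarith

/-! ### From false discoveries to the error rate -/

/-- If `k`-SLOPE makes `v ≥ k` false discoveries among `m₀` true nulls, then each of them has a
noise statistic of size at least `σ * λ_(v + m - m₀)`. -/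
theorem IsKSlopeEstimate.le_abs_noise {n m : ℕ} {X : Matrix (Fin n) (Fin m) ℝ}
    (hX : X.transpose * X = 1) {σ : ℝ} (hσ : 0 ≤ σ) {k : ℕ} (hk : 1 ≤ k) {α : ℝ}
    (hα : α ∈ Set.Ioo (0 : ℝ) 1) {β b : EuclideanSpace ℝ (Fin m)} {e : EuclideanSpace ℝ (Fin n)}
    (hb : IsKSlopeEstimate X σ k α (WithLp.toLp 2 (X.mulVec β.ofLp) + e) b)
    (hV : k ≤ numFalseDiscoveries β b) {i : Fin m} (hβi : β i = 0) (hbi : b i ≠ 0) :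
    σ * lambdaKFWER m k α
        (numFalseDiscoveries β b + (m - Fintype.card {i : Fin m // β i = 0})) + |b i| / 2 ≤
      |X.transpose.mulVec e.ofLp i| := by
  set V := numFalseDiscoveries β b with hVdef
  set S := Finset.univ.filter fun j => b j ≠ 0 with hS
  have hVS : V ≤ S.card := Finset.card_le_card fun j hj => by
    simp only [Finset.mem_filter, Finset.mem_univ, true_and, hS] at hj ⊢
    exact hj.2
  have hSm : S.card ≤ m := by simpa using Finset.card_le_univ S
  have hm₀ : Fintype.card {i : Fin m // β i = 0} ≤ m := by
    simpa using Fintype.card_subtype_le fun i : Fin m => β i = 0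
  have hVm : V ≤ Fintype.card {i : Fin m // β i = 0} := by
    rw [Fintype.card_subtype]
    exact Finset.card_le_card fun j hj => by
      simp only [Finset.mem_filter, Finset.mem_univ, true_and] at hj ⊢
      exact hj.1
  -- The selected features are V nulls and at most all m - m₀ non-nulls.
  have hSle : S.card ≤ V + (m - Fintype.card {i : Fin m // β i = 0}) := by
    have h1 := Finset.card_filter_add_card_filter_not (s := S) fun j => β j = 0
    have h2 : (S.filter fun j => β j = 0).card = V := by
      rw [hVdef, numFalseDiscoveries, hS, Finset.filter_filter]
      simp only [and_comm]
    have h3 : (S.filter fun j => ¬ β j = 0).card ≤ Fintype.card {i : Fin m // ¬ β i = 0} := by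
      rw [Fintype.card_subtype]
      exact Finset.card_le_card (Finset.filter_subset_filter _ (Finset.subset_univ _))
    rw [Fintype.card_subtype_compl, Fintype.card_fin] at h3
    omega
  have hl := lambdaKFWER_antitoneOn (m := m) hk (hV.trans (hVS.trans hSm)) hα
    (a := S.card) ⟨by omega, hSm⟩ (b := V + (m - Fintype.card {i : Fin m // β i = 0}))
    ⟨by omega, by omega⟩ hSle
  have h := hb.le_abs_mulVec hX hσ hk (hV.trans (hVS.trans hSm)) hα hbi
  have hy : X.transpose.mulVec (WithLp.toLp 2 (X.mulVec β.ofLp) + e).ofLp i =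
      X.transpose.mulVec e.ofLp i := by
    rw [WithLp.ofLp_add, Matrix.mulVec_add, Matrix.mulVec_mulVec, hX, Matrix.one_mulVec,
      Pi.add_apply, hβi, zero_add]
  rw [hy] at h
  nlinarith [mul_le_mul_of_nonneg_left hl hσ]

theorem theorem4 {Ω : Type*} [MeasurableSpace Ω] (P : Measure Ω) [IsProbabilityMeasure P]
    {n m : ℕ} (X : Matrix (Fin n) (Fin m) ℝ) (hX : X.transpose * X = 1)
    (β : EuclideanSpace ℝ (Fin m)) (σ : ℝ) (hσ : 0 ≤ σ)
    (ε : Ω → EuclideanSpace ℝ (Fin n))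
    (hε : HasLaw ε (multivariateGaussian 0 (σ ^ 2 • (1 : Matrix (Fin n) (Fin n) ℝ))) P)
    (y : Ω → EuclideanSpace ℝ (Fin n))
    (hy : ∀ ω, y ω = WithLp.toLp 2 (X.mulVec β.ofLp) + ε ω)
    (k : ℕ) (hk : 1 ≤ k) (α : ℝ) (hα : α ∈ Set.Ioo (0 : ℝ) 1)
    (βhat : Ω → EuclideanSpace ℝ (Fin m))
    (hβhat : ∀ᵐ ω ∂P, IsKSlopeEstimate X σ k α (y ω) (βhat ω)) :
    kFWER P k β βhat ≤ α := by
  simp_rw [hy] at hβhat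
  unfold kFWER
  refine ENNReal.toReal_le_of_le_ofReal hα.1.le ?_
  set m₀ := Fintype.card {i : Fin m // β i = 0} with hm₀
  have hm₀m : m₀ ≤ m := by simpa using Fintype.card_subtype_le fun i : Fin m => β i = 0
  rcases hσ.eq_or_lt with rfl | hσ
  · have hε0 : ∀ᵐ ω ∂P, ε ω = 0 := by
      have h : ∀ᵐ e ∂(multivariateGaussian 0 ((0 : ℝ) ^ 2 • (1 : Matrix (Fin n) (Fin n) ℝ))),
          e = 0 := by
        simp [multivariateGaussian, ae_dirac_eq]
      rw [← hε.map_eq] at h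
      exact ae_of_ae_map hε.aemeasurable h
    have hnull : P {ω | k ≤ numFalseDiscoveries β (βhat ω)} = 0 := by
      rw [measure_eq_zero_iff_ae_notMem]
      filter_upwards [hβhat, hε0] with ω hb he hV
      obtain ⟨i, hi⟩ := Finset.card_pos.1 (hk.trans hV)
      simp only [Finset.mem_filter, Finset.mem_univ, true_and] at hi
      -- Without noise the threshold is 0, and the surplus |b_i|/2 > 0 alone gives the
      -- contradiction.
      have h := hb.le_abs_noise hX le_rfl hk hα hV hi.1 hi.2
      have := abs_pos.2 hi.2
      rw [he] at h
      simp at h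
      linarith
    rw [hnull]
    exact zero_le
  · set G := multivariateGaussian 0 (σ ^ 2 • (1 : Matrix (Fin n) (Fin n) ℝ)) with hG
    let Z : {i : Fin m // β i = 0} → EuclideanSpace ℝ (Fin n) → ℝ :=
      fun i e => σ⁻¹ * X.transpose.mulVec e.ofLp i
    -- The cap `min v m₀` keeps the index at most m, where λ is monotone. The conditions k ≤ v and k
    -- ≤ m₀ empty the regions for which no tail bound is available.
    let A : ℕ → Set ℝ := fun v =>
      {x | k ≤ v ∧ k ≤ m₀ ∧ lambdaKFWER m k α (min v m₀ + (m - m₀)) ≤ |x|}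
    have hZ : ∀ i, Measurable (Z i) := fun i => by
      have : Continuous (Z i) := continuous_const.mul
        ((continuous_apply _).comp (Continuous.matrix_mulVec continuous_const (by fun_prop)))
      exact this.measurable
    have hA : Monotone A := by
      rintro v w hvw x ⟨h1, h2, h3⟩
      refine ⟨h1.trans hvw, h2, le_trans ?_ h3⟩
      exact lambdaKFWER_antitoneOn hk (h2.trans hm₀m) hα ⟨by omega, by omega⟩
        ⟨by omega, by omega⟩ (by omega)
    have hAm : ∀ v, MeasurableSet (A v) := fun v =>
      (MeasurableSet.const _).inter ((MeasurableSet.const _).inter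
        (measurableSet_le measurable_const continuous_abs.measurable))
    have hc : ∀ i v, G (Z i ⁻¹' A v) ≤ v * ENNReal.ofReal (α / m₀) := by
      intro i v
      rw [← Measure.map_apply (hZ i) (hAm v),
        (gaussianReal_iIndepFun_mulVec_transpose_multivariateGaussian hX hσ i.1).1]
      by_cases h : k ≤ v ∧ k ≤ m₀
      · calc gaussianReal 0 1 (A v)
            ≤ gaussianReal 0 1 {x | lambdaKFWER m k α (min v m₀ + (m - m₀)) ≤ |x|} :=
              measure_mono fun x hx => hx.2.2
          _ ≤ (min v m₀ : ℕ) * ENNReal.ofReal (α / m₀) :=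
              prob_lambdaKFWER_le hk hα hm₀m (le_min h.1 h.2) (min_le_right _ _)
          _ ≤ v * ENNReal.ofReal (α / m₀) := by
              gcongr
              exact min_le_left _ _
      · have : A v = ∅ := Set.eq_empty_of_forall_notMem fun x hx => h ⟨hx.1, hx.2.1⟩
        simp [this]
    have hind : iIndepFun Z G := by
      rcases isEmpty_or_nonempty (Fin m) with hE | ⟨⟨i⟩⟩
      · exact iIndepFun.of_subsingleton
      · exact (gaussianReal_iIndepFun_mulVec_transpose_multivariateGaussian hX hσ i).2.precomp
          Subtype.val_injective
    have hsimes := simes_inequality hZ hind hA hAm hc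
    set E := {e | ∃ v, 1 ≤ v ∧ v ≤ Set.ncard {i | Z i e ∈ A v}}
    calc P {ω | k ≤ numFalseDiscoveries β (βhat ω)} ≤ P (ε ⁻¹' E) := by
          -- `βhat` need not be measurable: its event is contained almost surely in one determined
          -- by the noise.
          refine measure_mono_ae ?_
          filter_upwards [hβhat] with ω hb hV
          change k ≤ numFalseDiscoveries β (βhat ω) at hV
          set V := numFalseDiscoveries β (βhat ω) with hVdef
          have hVm : V ≤ m₀ := by
            rw [hm₀, Fintype.card_subtype]
            exact Finset.card_le_card fun j hj => by
              simp only [Finset.mem_filter, Finset.mem_univ, true_and] at hj ⊢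
              exact hj.1
          refine ⟨V, hk.trans hV, ?_⟩
          have hcard : V = Set.ncard {i : {i : Fin m // β i = 0} | βhat ω i ≠ 0} := by
            rw [← Set.ncard_image_of_injective _ Subtype.val_injective, hVdef,
              numFalseDiscoveries, ← Set.ncard_coe_finset]
            congr 1
            ext j
            simp [and_comm]
          rw [hcard]
          refine Set.ncard_le_ncard (fun i hi => ?_)
          have h := hb.le_abs_noise hX hσ.le hk hα hV i.2 hi
          refine ⟨hcard ▸ hV, hV.trans hVm, ?_⟩
          rw [← hcard, min_eq_left hVm]
          change _ ≤ |σ⁻¹ * _|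
          rw [abs_mul, abs_of_pos (inv_pos.2 hσ), le_inv_mul_iff₀ hσ]
          linarith [abs_nonneg (βhat ω i)]
      _ ≤ G E := by
          rw [← hε.map_eq]
          exact Measure.le_map_apply hε.aemeasurable _
      _ ≤ m₀ * ENNReal.ofReal (α / m₀) := hsimes
      _ ≤ ENNReal.ofReal α := by
          rw [← ENNReal.ofReal_natCast, ← ENNReal.ofReal_mul (by positivity)]
          refine ENNReal.ofReal_le_ofReal ?_
          -- If there are no nulls, α / 0 = 0 and the bound reads 0 ≤ α.
          rcases Nat.eq_zero_or_pos m₀ with h | h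
          · simp [h, hα.1.le]
          · rw [mul_div_cancel₀]
            exact_mod_cast h.ne'
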